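/- Let $\mathbb{D}=\{z\in\mathbb{C}:|z|<1\}$ and let $\mathcal{A}$ be the class of functions $f$ analytic on $\mathbb{D}$ with $f(0)=0$ and $f'(0)=1$, so that $f(z)=z+\sum_{n\ge 2}a_nz^n$ (and $a_1=1$). For analytic functions $h_1,h_2$ on $\mathbb{D}$ write $h_1\prec h_2$ if there is an analytic $w:\mathbb{D}\to\mathbb{D}$ with $w(0)=0$, $|w(z)|\le|z|$ and $h_1(z)=h_2(w(z))$ for all $z\in\mathbb{D}$. Let $$\mathcal{C}_e=\left\{f\in\mathcal{A}: f'\neq 0\text{ on }\mathbb{D},\ 1+\frac{zf''(z)}{f'(z)}\prec e^z\right\},$$ and let $$H_{3,1}(f)=\begin{vmatrix}a_1&a_2&a_3\\a_2&a_3&a_4\\a_3&a_4&a_5\end{vmatrix}=2a_2a_3a_4-a_3^3-a_4^2-a_2^2a_5+a_3a_5 .$$ Then for every $f\in\mathcal{C}_e$, $$|H_{3,1}(f)|\le\frac{1}{144}.$$ This bound is sharp: the function $$f_2(z)=\int_0^z\exp\left(\int_0^y\frac{e^{t^3}-1}{t}\,dt\right)dy$$ belongs to $\mathcal{C}_e$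 and satisfies $|H_{3,1}(f_2)|=\frac{1}{144}$. -/

import Mathlib

open Metric

noncomputable section

/-- The open unit disk `𝔻 = {z ∈ ℂ : |z| < 1}`. -/
def unitDisk : Set ℂ := ball 0 1

/-- The class `𝒜`: functions analytic on the open unit disk, normalized by
`f 0 = 0` and `f' 0 = 1`, i.e. `f z = z + ∑ n ≥ 2, aₙ zⁿ`. -/
def IsNormalizedAnalytic (f : ℂ → ℂ) : Prop :=
  DifferentiableOn ℂ f unitDisk ∧ f 0 = 0 ∧ deriv f 0 = 1

/-- A Schwarz function: analytic on the disk, `w 0 = 0` and `|w z| ≤ |z|`. -/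
def IsSchwarz (w : ℂ → ℂ) : Prop :=
  DifferentiableOn ℂ w unitDisk ∧ w 0 = 0 ∧ ∀ z ∈ unitDisk, ‖w z‖ ≤ ‖z‖

/-- Subordination `h₁ ≺ h₂` of functions analytic on the disk: `h₁ = h₂ ∘ w` on the disk
for some Schwarz function `w`. -/
def IsSubordinate (h₁ h₂ : ℂ → ℂ) : Prop :=
  DifferentiableOn ℂ h₁ unitDisk ∧ DifferentiableOn ℂ h₂ unitDisk ∧
    ∃ w : ℂ → ℂ, IsSchwarz w ∧ ∀ z ∈ unitDisk, h₁ z = h₂ (w z)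

/-- The class `𝒞(φ)`: those `f ∈ 𝒜` with `1 + z f''(z) / f'(z) ≺ φ(z)`. The derivative is required
to have no zero in the disk, so that the quotient is meaningful there. -/
def convexClass (φ : ℂ → ℂ) : Set (ℂ → ℂ) :=
  {f | IsNormalizedAnalytic f ∧ (∀ z ∈ unitDisk, deriv f z ≠ 0) ∧
    IsSubordinate (fun z => 1 + z * deriv (deriv f) z / deriv f z) φ}

/-- The class `𝒞ₑ = 𝒞(exp)`. -/
def convexClassExp : Set (ℂ → ℂ) := convexClass Complex.exp

/-- The `n`-th Taylor coefficient `aₙ` of `f` at the origin. -/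
def taylorCoeff (f : ℂ → ℂ) (n : ℕ) : ℂ := iteratedDeriv n f 0 / (n.factorial : ℂ)

/-- The Hankel determinant `H_{q,n}(f)`, the determinant of the `q × q` matrix
with entries `a_{n+i+j}`, `0 ≤ i, j < q`. -/
def hankelDet (q n : ℕ) (f : ℂ → ℂ) : ℂ :=
  (Matrix.of fun i j : Fin q => taylorCoeff f (n + i.val + j.val)).det

/-- The complex line integral `∫₀ᶻ h(t) dt` along the segment from `0` to `z`. -/
def integralFromZero (h : ℂ → ℂ) (z : ℂ) : ℂ := ∫ s in (0 : ℝ)..1, z * h ((s : ℂ) * z)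

/-- The function `f₂(z) = ∫₀ᶻ exp (∫₀ʸ (exp (t³) - 1) / t dt) dy`. The inner integrand has a
removable singularity at `t = 0`; its value at that one point does not affect the integral. -/
def extremalFunction : ℂ → ℂ :=
  integralFromZero fun y =>
    Complex.exp (integralFromZero (fun t => (Complex.exp (t ^ 3) - 1) / t) y)

end

/-!
For `f` in the class write `1 + z f'' / f' = exp ∘ w` with a Schwarz function
`w z = c₁ z + c₂ z² + ⋯`. Comparing Taylor coefficients in `(z f')' = f' · (exp ∘ w)` and
`(exp ∘ w)' = w' · (exp ∘ w)` turns the Hankel determinant into a polynomial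
(`hankelDet_eq_of_exp_comp`):
`144 H = -c₃² + 6/5 c₂c₄ + 8/15 c₂³ - c₁c₂c₃/5 - c₁²c₂²/4 + c₁³c₃/6 + c₁⁴c₂/60 - c₁⁶/144`.

The only property of the Schwarz function needed for the bound is
`|c₁|² + |c₂|² + |c₃|² + |c₄|² ≤ 1` (`sum_sq_taylorCoeff_le_one`), which is Parseval's identity on
circles of radius tending to `1`. After the triangle inequality, `6/5 |c₂c₄|` is at most
`|c₄|² + 9/25 |c₂|²`, and the remaining terms are so small that the whole sum is at most
`|c₁|² + |c₂|² + |c₃|² + |c₄|²` (`coeff_polynomial_le_one`).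

Equality forces `|c₃| = 1`, which is the case `w z = z³`. The extremal function solves
`1 + z f'' / f' = exp (z³)`, so the same polynomial gives `144 H = -1` for it.
-/

/-! ### Taylor coefficients -/

theorem unitDisk_mem_nhds_zero : unitDisk ∈ nhds (0 : ℂ) :=
  ball_mem_nhds 0 one_pos

theorem analyticAt_of_differentiableOn_unitDisk {f : ℂ → ℂ} (hf : DifferentiableOn ℂ f unitDisk)
    {z : ℂ} (hz : z ∈ unitDisk) : AnalyticAt ℂ f z :=
  hf.analyticAt (isOpen_ball.mem_nhds hz)

theorem taylorCoeff_zero (f : ℂ → ℂ) : taylorCoeff f 0 = f 0 := by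
  simp [taylorCoeff]

theorem taylorCoeff_one (f : ℂ → ℂ) : taylorCoeff f 1 = deriv f 0 := by
  simp [taylorCoeff]

theorem taylorCoeff_congr {f g : ℂ → ℂ} (h : f =ᶠ[nhds 0] g) (n : ℕ) :
    taylorCoeff f n = taylorCoeff g n := by
  rw [taylorCoeff, taylorCoeff, h.iteratedDeriv_eq n]

theorem taylorCoeff_deriv (f : ℂ → ℂ) (n : ℕ) :
    taylorCoeff (deriv f) n = (n + 1) * taylorCoeff f (n + 1) := by
  have h1 : ((n : ℂ) + 1) ≠ 0 := by exact_mod_cast n.succ_ne_zero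
  have h2 : (n.factorial : ℂ) ≠ 0 := by exact_mod_cast n.factorial_ne_zero
  rw [taylorCoeff, taylorCoeff, iteratedDeriv_succ', Nat.factorial_succ]
  push_cast
  field_simp

theorem taylorCoeff_mul {f g : ℂ → ℂ} (hf : AnalyticAt ℂ f 0) (hg : AnalyticAt ℂ g 0) (n : ℕ) :
    taylorCoeff (f * g) n =
      ∑ i ∈ Finset.range (n + 1), taylorCoeff f i * taylorCoeff g (n - i) := by
  rw [taylorCoeff, iteratedDeriv_mul hf.contDiffAt hg.contDiffAt, Finset.sum_div]
  refine Finset.sum_congr rfl fun i hi => ?_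
  have hin : i ≤ n := Nat.lt_succ_iff.mp (Finset.mem_range.mp hi)
  rw [Nat.cast_choose ℂ hin, taylorCoeff, taylorCoeff]
  have h1 : (n.factorial : ℂ) ≠ 0 := by exact_mod_cast n.factorial_ne_zero
  have h2 : (i.factorial : ℂ) ≠ 0 := by exact_mod_cast i.factorial_ne_zero
  have h3 : ((n - i).factorial : ℂ) ≠ 0 := by exact_mod_cast (n - i).factorial_ne_zero
  field_simp

theorem taylorCoeff_pow (m n : ℕ) :
    taylorCoeff (fun z => z ^ m) n = if n = m then 1 else 0 := by
  rw [taylorCoeff, iteratedDeriv_fun_pow_zero]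
  split_ifs with h
  · subst h
    exact div_self (by exact_mod_cast n.factorial_ne_zero)
  · simp

theorem taylorCoeff_id_mul {g : ℂ → ℂ} (hg : AnalyticAt ℂ g 0) (n : ℕ) :
    taylorCoeff ((fun z => z) * g) (n + 1) = taylorCoeff g n := by
  have h (i : ℕ) : taylorCoeff (fun z => z) i = if i = 1 then 1 else 0 := by
    simpa using taylorCoeff_pow 1 i
  rw [taylorCoeff_mul (f := fun z => z) analyticAt_id hg, Finset.sum_eq_single 1]
  · simp [h]
  · intro i _ hi
    simp [h, hi]
  · simp

/-! ### The Hankel determinant in terms of the Schwarz function -/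

/-- The recurrence for the Taylor coefficients of `exp ∘ w` that comes from
`(exp ∘ w)' = w' · (exp ∘ w)`. -/
theorem taylorCoeff_exp_comp_succ {w : ℂ → ℂ} (hw : AnalyticAt ℂ w 0) (n : ℕ) :
    (n + 1) * taylorCoeff (fun z => Complex.exp (w z)) (n + 1) =
      ∑ i ∈ Finset.range (n + 1),
        (i + 1) * taylorCoeff w (i + 1) * taylorCoeff (fun z => Complex.exp (w z)) (n - i) := by
  have hp : AnalyticAt ℂ (fun z => Complex.exp (w z)) 0 := hw.cexp
  have h : deriv (fun z => Complex.exp (w z)) =ᶠ[nhds 0]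
      deriv w * fun z => Complex.exp (w z) := by
    filter_upwards [hw.eventually_analyticAt] with z hz
    rw [hz.differentiableAt.hasDerivAt.cexp.deriv, Pi.mul_apply, mul_comm]
  rw [← taylorCoeff_deriv, taylorCoeff_congr h, taylorCoeff_mul hw.deriv hp]
  simp_rw [taylorCoeff_deriv]

/-- If `1 + z f'' / f' = p`, then `(z f')' = f' p`; comparing Taylor coefficients expresses each
coefficient of `f` through the earlier ones and those of `p`. -/
theorem taylorCoeff_recurrence {f p : ℂ → ℂ} (hf : AnalyticAt ℂ f 0) (hp : AnalyticAt ℂ p 0)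
    (h0 : ∀ᶠ z in nhds 0, deriv f z ≠ 0)
    (h : ∀ᶠ z in nhds 0, 1 + z * deriv (deriv f) z / deriv f z = p z) (n : ℕ) :
    (n + 1) * ((n + 1) * taylorCoeff f (n + 1)) =
      ∑ i ∈ Finset.range (n + 1), (i + 1) * taylorCoeff f (i + 1) * taylorCoeff p (n - i) := by
  have hg := hf.deriv
  have key : deriv ((fun z => z) * deriv f) =ᶠ[nhds 0] deriv f * p := by
    filter_upwards [h0, h, hg.eventually_analyticAt] with z hz hpz hgz
    rw [((hasDerivAt_id' z).mul hgz.differentiableAt.hasDerivAt).deriv, Pi.mul_apply, ← hpz]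
    field_simp
  have := taylorCoeff_congr key n
  rw [taylorCoeff_deriv, taylorCoeff_id_mul hg, taylorCoeff_mul hg hp] at this
  simp_rw [taylorCoeff_deriv] at this
  exact this

theorem hankelDet_three_one (f : ℂ → ℂ) :
    hankelDet 3 1 f =
      taylorCoeff f 1 * (taylorCoeff f 3 * taylorCoeff f 5 - taylorCoeff f 4 ^ 2) -
        taylorCoeff f 2 * (taylorCoeff f 2 * taylorCoeff f 5 - taylorCoeff f 3 * taylorCoeff f 4) +
        taylorCoeff f 3 * (taylorCoeff f 2 * taylorCoeff f 4 - taylorCoeff f 3 ^ 2) := by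
  simp [hankelDet, Matrix.det_fin_three]
  ring

/-- The Hankel determinant of a function with `1 + z f'' / f' = exp ∘ w` as a polynomial in the
first four Taylor coefficients of `w`. There is no monomial `c₁² c₄`: the coefficient of `c₄` is
`a₃ - a₂²` up to a constant, in which the terms in `c₁²` cancel. -/
theorem hankelDet_eq_of_exp_comp {f w : ℂ → ℂ} (hf : IsNormalizedAnalytic f)
    (hf' : ∀ z ∈ unitDisk, deriv f z ≠ 0) (hw : DifferentiableOn ℂ w unitDisk) (hw0 : w 0 = 0)
    (h : ∀ z ∈ unitDisk, 1 + z * deriv (deriv f) z / deriv f z = Complex.exp (w z)) :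
    144 * hankelDet 3 1 f =
      -taylorCoeff w 3 ^ 2 + 6 / 5 * (taylorCoeff w 2 * taylorCoeff w 4) +
        8 / 15 * taylorCoeff w 2 ^ 3 - 1 / 5 * (taylorCoeff w 1 * taylorCoeff w 2 * taylorCoeff w 3)
        - 1 / 4 * (taylorCoeff w 1 ^ 2 * taylorCoeff w 2 ^ 2) +
        1 / 6 * (taylorCoeff w 1 ^ 3 * taylorCoeff w 3) +
        1 / 60 * (taylorCoeff w 1 ^ 4 * taylorCoeff w 2) - 1 / 144 * taylorCoeff w 1 ^ 6 := by
  have hz : (0 : ℂ) ∈ unitDisk := mem_ball_self one_pos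
  have hwa := analyticAt_of_differentiableOn_unitDisk hw hz
  have hfa := analyticAt_of_differentiableOn_unitDisk hf.1 hz
  have hP := taylorCoeff_exp_comp_succ hwa
  have hA := taylorCoeff_recurrence (p := fun z => Complex.exp (w z)) hfa hwa.cexp
    (Filter.eventually_of_mem unitDisk_mem_nhds_zero hf')
    (Filter.eventually_of_mem unitDisk_mem_nhds_zero h)
  have hP0 : taylorCoeff (fun z => Complex.exp (w z)) 0 = 1 := by simp [taylorCoeff_zero, hw0]
  have hA1 : taylorCoeff f 1 = 1 := by rw [taylorCoeff_one, hf.2.2]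
  rw [hankelDet_three_one]
  have p1 := hP 0
  have p2 := hP 1
  have p3 := hP 2
  have p4 := hP 3
  have e2 := hA 1
  have e3 := hA 2
  have e4 := hA 3
  have e5 := hA 4
  simp only [Finset.sum_range_succ, Finset.sum_range_zero, Nat.sub_zero, Nat.sub_self, hP0, hA1,
    Nat.reduceSub, Nat.reduceAdd, Nat.cast_zero, Nat.cast_one, Nat.cast_ofNat]
    at p1 p2 p3 p4 e2 e3 e4 e5 ⊢
  generalize taylorCoeff (fun z => Complex.exp (w z)) = P at *
  generalize taylorCoeff f = a at *
  generalize taylorCoeff w = c at *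
  have p1' : P 1 = c 1 := by linear_combination p1
  rw [p1'] at p2 p3 p4 e2 e3 e4 e5
  have p2' : P 2 = c 2 + c 1 ^ 2 / 2 := by linear_combination p2 / 2
  rw [p2'] at p3 p4 e3 e4 e5
  have p3' : P 3 = c 3 + c 1 * c 2 + c 1 ^ 3 / 6 := by linear_combination p3 / 3
  rw [p3'] at p4 e4 e5
  have p4' : P 4 = c 4 + c 1 * c 3 + c 2 ^ 2 / 2 + c 1 ^ 2 * c 2 / 2 + c 1 ^ 4 / 24 := by
    linear_combination p4 / 4
  rw [p4'] at e5
  have e2' : a 2 = c 1 / 2 := by linear_combination e2 / 2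
  rw [e2'] at e3 e4 e5 ⊢
  have e3' : a 3 = c 2 / 6 + c 1 ^ 2 / 4 := by linear_combination e3 / 6
  rw [e3'] at e4 e5 ⊢
  have e4' : a 4 = c 3 / 12 + 5 / 24 * (c 1 * c 2) + 17 / 144 * c 1 ^ 3 := by
    linear_combination e4 / 12
  rw [e4'] at e5 ⊢
  linear_combination 144 * (c 2 / 6) * e5 / 20

/-! ### Coefficients of bounded functions -/

/-- Cauchy's formula: the Fourier coefficients of `w` on the circle of radius `r` are the
`rⁿ cₙ`. -/
theorem fourierCoeffOn_circleMap {w : ℂ → ℂ} {r : ℝ} (hr : 0 < r)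
    (hw : DifferentiableOn ℂ w (closedBall 0 r)) (n : ℕ) :
    fourierCoeffOn Real.two_pi_pos (fun θ => w (circleMap 0 r θ)) n = r ^ n * taylorCoeff w n := by
  have h := hw.circleIntegral_one_div_sub_center_pow_smul hr n
  have hr' : (r : ℂ) ≠ 0 := by exact_mod_cast hr.ne'
  have hpi : (Real.pi : ℂ) ≠ 0 := by exact_mod_cast Real.pi_ne_zero
  have hfac : (n.factorial : ℂ) ≠ 0 := by exact_mod_cast n.factorial_ne_zero
  rw [fourierCoeffOn_eq_integral]
  have hi : ∫ θ in (0 : ℝ)..2 * Real.pi,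
      fourier (-(n : ℤ)) (θ : AddCircle (2 * Real.pi - 0)) • w (circleMap 0 r θ) =
      r ^ n * Complex.I⁻¹ * ∮ z in C(0, r), (1 / (z - 0) ^ (n + 1)) • w z := by
    rw [circleIntegral, ← intervalIntegral.integral_const_mul]
    refine intervalIntegral.integral_congr fun θ _ => ?_
    have he : Complex.exp (θ * Complex.I) ≠ 0 := Complex.exp_ne_zero _
    have : Complex.exp (2 * Real.pi * Complex.I * (-(n : ℤ) : ℤ) * θ / ((2 * Real.pi : ℝ) : ℂ)) =
        (Complex.exp (θ * Complex.I) ^ n)⁻¹ := by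
      rw [← Complex.exp_nat_mul, ← Complex.exp_neg]
      congr 1
      push_cast
      field_simp
    simp only [fourier_coe_apply, this, deriv_circleMap, circleMap, smul_eq_mul, zero_add, sub_zero]
    field_simp
    ring
  rw [hi, h, taylorCoeff, Complex.real_smul]
  push_cast
  simp only [smul_eq_mul]
  field_simp
  ring

/-- Bessel's inequality for the boundary values on smaller circles: the coefficients of an analytic
function bounded by `1` on the disk have square sum at most `1`. -/
theorem sum_sq_taylorCoeff_le_one {w : ℂ → ℂ} (hw : DifferentiableOn ℂ w unitDisk)
    (hb : ∀ z ∈ unitDisk, ‖w z‖ ≤ 1) (s : Finset ℕ) :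
    ∑ n ∈ s, ‖taylorCoeff w n‖ ^ 2 ≤ 1 := by
  have hr : ∀ r ∈ Set.Ioo (0 : ℝ) 1, ∑ n ∈ s, ‖(r : ℂ) ^ n * taylorCoeff w n‖ ^ 2 ≤ 1 := by
    rintro r ⟨hr0, hr1⟩
    have hsub : closedBall (0 : ℂ) r ⊆ unitDisk := closedBall_subset_ball hr1
    have hmem (θ : ℝ) : circleMap 0 r θ ∈ unitDisk :=
      hsub (circleMap_mem_closedBall 0 hr0.le θ)
    have hcont : Continuous fun θ => w (circleMap 0 r θ) :=
      hw.continuousOn.comp_continuous (continuous_circleMap 0 r) hmem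
    have hL2 : MeasureTheory.MemLp (fun θ => w (circleMap 0 r θ)) 2
        (MeasureTheory.volume.restrict (Set.Ioc 0 (2 * Real.pi))) :=
      MeasureTheory.MemLp.of_bound hcont.aestronglyMeasurable 1
        (Filter.Eventually.of_forall fun θ => hb _ (hmem θ))
    have hsum := hasSum_sq_fourierCoeffOn Real.two_pi_pos hL2
    have hint : (2 * Real.pi - 0)⁻¹ • ∫ θ in (0 : ℝ)..2 * Real.pi, ‖w (circleMap 0 r θ)‖ ^ 2 ≤ 1 := by
      have : ∫ θ in (0 : ℝ)..2 * Real.pi, ‖w (circleMap 0 r θ)‖ ^ 2 ≤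
          ∫ _ in (0 : ℝ)..2 * Real.pi, (1 : ℝ) :=
        intervalIntegral.integral_mono_on Real.two_pi_pos.le
          ((hcont.norm.pow 2).intervalIntegrable _ _) intervalIntegrable_const
          fun θ _ => pow_le_one₀ (norm_nonneg _) (hb _ (hmem θ))
      rw [smul_eq_mul, inv_mul_le_iff₀ (by simpa using Real.pi_pos)]
      simpa using this
    calc ∑ n ∈ s, ‖(r : ℂ) ^ n * taylorCoeff w n‖ ^ 2
        = ∑ k ∈ s.map Nat.castEmbedding,
            ‖fourierCoeffOn Real.two_pi_pos (fun θ => w (circleMap 0 r θ)) k‖ ^ 2 := by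
          rw [Finset.sum_map]
          refine Finset.sum_congr rfl fun n _ => ?_
          rw [Nat.castEmbedding_apply, fourierCoeffOn_circleMap hr0 (hw.mono hsub)]
      _ ≤ _ := sum_le_hasSum _ (fun _ _ => by positivity) hsum
      _ ≤ 1 := hint
  have hlim : Filter.Tendsto (fun r : ℝ => ∑ n ∈ s, ‖(r : ℂ) ^ n * taylorCoeff w n‖ ^ 2)
      (nhdsWithin 1 (Set.Iio 1)) (nhds (∑ n ∈ s, ‖taylorCoeff w n‖ ^ 2)) := by
    have hc : Continuous fun r : ℝ => ∑ n ∈ s, ‖(r : ℂ) ^ n * taylorCoeff w n‖ ^ 2 := by fun_prop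
    simpa using (hc.tendsto 1).mono_left nhdsWithin_le_nhds
  exact le_of_tendsto hlim (Filter.eventually_of_mem (Ioo_mem_nhdsLT one_pos) hr)

/-! ### The upper bound -/

/-- The factor `6 / 5` is absorbed by `6/5 y v ≤ v² + 9/25 y²`; what remains is at most
`x² + y²` because `8/15 + 9/25 + 1/20 < 1` and `1/5 + 1/4 + 1/6 + 1/60 + 1/144 < 1`. -/
theorem coeff_polynomial_le_one {x y u v : ℝ} (hx : 0 ≤ x) (hy : 0 ≤ y) (hu : 0 ≤ u)
    (h : x ^ 2 + y ^ 2 + u ^ 2 + v ^ 2 ≤ 1) :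
    u ^ 2 + 6 / 5 * (y * v) + 8 / 15 * y ^ 3 + 1 / 5 * (x * y * u) + 1 / 4 * (x ^ 2 * y ^ 2) +
      1 / 6 * (x ^ 3 * u) + 1 / 60 * (x ^ 4 * y) + 1 / 144 * x ^ 6 ≤ 1 := by
  have hx1 : x ≤ 1 := by nlinarith [sq_nonneg y, sq_nonneg u, sq_nonneg v]
  have hy1 : y ≤ 1 := by nlinarith [sq_nonneg x, sq_nonneg u, sq_nonneg v]
  have hu1 : u ≤ 1 := by nlinarith [sq_nonneg x, sq_nonneg y, sq_nonneg v]
  have t1 : 6 / 5 * (y * v) ≤ v ^ 2 + 9 / 25 * y ^ 2 := by nlinarith [sq_nonneg (v - 3 / 5 * y)]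
  have t2 : y ^ 3 ≤ y ^ 2 := pow_le_pow_of_le_one hy hy1 (by norm_num)
  have t3 : x * y * u ≤ x ^ 2 + y ^ 2 / 4 := by
    have : x * y * u ≤ x * y := mul_le_of_le_one_right (by positivity) hu1
    nlinarith [sq_nonneg (x - y / 2)]
  have t4 : x ^ 2 * y ^ 2 ≤ x ^ 2 := mul_le_of_le_one_right (by positivity) (pow_le_one₀ hy hy1)
  have t5 : x ^ 3 * u ≤ x ^ 2 :=
    (mul_le_of_le_one_right (by positivity) hu1).trans (pow_le_pow_of_le_one hx hx1 (by norm_num))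
  have t6 : x ^ 4 * y ≤ x ^ 2 :=
    (mul_le_of_le_one_right (by positivity) hy1).trans (pow_le_pow_of_le_one hx hx1 (by norm_num))
  have t7 : x ^ 6 ≤ x ^ 2 := pow_le_pow_of_le_one hx hx1 (by norm_num)
  nlinarith [sq_nonneg x, sq_nonneg y]

theorem norm_hankelDet_le {f : ℂ → ℂ} (hf : f ∈ convexClassExp) :
    ‖hankelDet 3 1 f‖ ≤ 1 / 144 := by
  obtain ⟨hn, hd, -, -, w, ⟨hw, hw0, hwb⟩, h⟩ := hf
  have hH := hankelDet_eq_of_exp_comp hn hd hw hw0 h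
  have hsq := sum_sq_taylorCoeff_le_one hw
    (fun z hz => (hwb z hz).trans (mem_ball_zero_iff.mp hz).le) {1, 2, 3, 4}
  rw [Finset.sum_insert (by decide), Finset.sum_insert (by decide), Finset.sum_insert (by decide),
    Finset.sum_singleton] at hsq
  have hle := coeff_polynomial_le_one (norm_nonneg (taylorCoeff w 1))
    (norm_nonneg (taylorCoeff w 2)) (norm_nonneg (taylorCoeff w 3))
    (v := ‖taylorCoeff w 4‖) (by linarith)
  generalize taylorCoeff w = c at *
  have htri : ‖144 * hankelDet 3 1 f‖ ≤ ‖c 3‖ ^ 2 + 6 / 5 * (‖c 2‖ * ‖c 4‖) + 8 / 15 * ‖c 2‖ ^ 3 +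
      1 / 5 * (‖c 1‖ * ‖c 2‖ * ‖c 3‖) + 1 / 4 * (‖c 1‖ ^ 2 * ‖c 2‖ ^ 2) +
      1 / 6 * (‖c 1‖ ^ 3 * ‖c 3‖) + 1 / 60 * (‖c 1‖ ^ 4 * ‖c 2‖) + 1 / 144 * ‖c 1‖ ^ 6 := by
    rw [hH]
    refine (norm_sub_le_of_le (norm_add_le_of_le (norm_add_le_of_le (norm_sub_le_of_le
      (norm_sub_le_of_le (norm_add_le_of_le (norm_add_le_of_le le_rfl le_rfl) le_rfl) le_rfl)
      le_rfl) le_rfl) le_rfl) le_rfl).trans (le_of_eq ?_)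
    norm_num [norm_mul, norm_pow]
  rw [norm_mul] at htri
  norm_num at htri
  linarith

/-! ### The extremal function -/

theorem hasDerivAt_integralFromZero {h : ℂ → ℂ} (hh : DifferentiableOn ℂ h unitDisk) {z : ℂ}
    (hz : z ∈ unitDisk) : HasDerivAt (integralFromZero h) (h z) z := by
  obtain ⟨F, hF0, hF⟩ := (DifferentiableOn.isExactOn_ball hh).with_val_at 0 0
  have heq : ∀ y ∈ unitDisk, integralFromZero h y = F y := by
    intro y hy
    have hmem : ∀ s ∈ Set.uIcc (0 : ℝ) 1, (s : ℂ) * y ∈ unitDisk := by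
      intro s hs
      rw [Set.uIcc_of_le zero_le_one] at hs
      have hy' : ‖y‖ < 1 := mem_ball_zero_iff.mp hy
      refine mem_ball_zero_iff.mpr ?_
      rw [norm_mul, Complex.norm_real, Real.norm_of_nonneg hs.1]
      exact (mul_le_of_le_one_left (norm_nonneg y) hs.2).trans_lt hy'
    have hderiv : ∀ s ∈ Set.uIcc (0 : ℝ) 1,
        HasDerivAt (fun s : ℝ => F (s * y)) (y * h (s * y)) s := by
      intro s hs
      have h1 : HasDerivAt (fun s : ℝ => (s : ℂ) * y) y s := by
        simpa using (Complex.ofRealCLM.hasDerivAt (x := s)).mul_const y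
      exact ((hF _ (hmem s hs)).comp s h1).congr_deriv (mul_comm _ _)
    have hcont : ContinuousOn (fun s : ℝ => y * h (s * y)) (Set.uIcc 0 1) :=
      continuousOn_const.mul (hh.continuousOn.comp (by fun_prop) hmem)
    rw [integralFromZero, intervalIntegral.integral_eq_sub_of_hasDerivAt hderiv
      hcont.intervalIntegrable]
    simp [hF0]
  exact (hF z hz).congr_of_eventuallyEq (Filter.eventually_of_mem (isOpen_ball.mem_nhds hz) heq)

theorem integralFromZero_zero (h : ℂ → ℂ) : integralFromZero h 0 = 0 := by
  simp [integralFromZero]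

/-- The division by zero at the origin gives `0`, which is the value that removes the
singularity. -/
theorem differentiable_exp_cube_sub_one_div :
    Differentiable ℂ fun t : ℂ => (Complex.exp (t ^ 3) - 1) / t := by
  have hE : Differentiable ℂ fun t : ℂ => Complex.exp (t ^ 3) := by fun_prop
  have h : (fun t : ℂ => (Complex.exp (t ^ 3) - 1) / t) =
      dslope (fun t : ℂ => Complex.exp (t ^ 3)) 0 := by
    funext t
    rcases eq_or_ne t 0 with rfl | ht
    · rw [dslope_same, ((hasDerivAt_pow 3 (0 : ℂ)).cexp).deriv]
      simp
    · rw [dslope_of_ne _ ht, slope_def_field]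
      simp
  rw [h, ← differentiableOn_univ, Complex.differentiableOn_dslope Filter.univ_mem]
  exact hE.differentiableOn

theorem hasDerivAt_extremalFunction {z : ℂ} (hz : z ∈ unitDisk) :
    HasDerivAt extremalFunction
      (Complex.exp (integralFromZero (fun t => (Complex.exp (t ^ 3) - 1) / t) z)) z :=
  hasDerivAt_integralFromZero (fun _ hy => (hasDerivAt_integralFromZero
    differentiable_exp_cube_sub_one_div.differentiableOn
      hy).cexp.differentiableAt.differentiableWithinAt) hz

theorem isNormalizedAnalytic_extremalFunction : IsNormalizedAnalytic extremalFunction := by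
  refine ⟨fun z hz => (hasDerivAt_extremalFunction hz).differentiableAt.differentiableWithinAt,
    integralFromZero_zero _, ?_⟩
  rw [(hasDerivAt_extremalFunction (mem_ball_self one_pos)).deriv, integralFromZero_zero,
    Complex.exp_zero]

theorem deriv_extremalFunction_ne_zero {z : ℂ} (hz : z ∈ unitDisk) :
    deriv extremalFunction z ≠ 0 := by
  rw [(hasDerivAt_extremalFunction hz).deriv]
  exact Complex.exp_ne_zero _

theorem one_add_mul_deriv_deriv_extremalFunction {z : ℂ} (hz : z ∈ unitDisk) :
    1 + z * deriv (deriv extremalFunction) z / deriv extremalFunction z =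
      Complex.exp (z ^ 3) := by
  have heq : deriv extremalFunction =ᶠ[nhds z] fun y =>
      Complex.exp (integralFromZero (fun t => (Complex.exp (t ^ 3) - 1) / t) y) :=
    Filter.eventually_of_mem (isOpen_ball.mem_nhds hz) fun y hy =>
      (hasDerivAt_extremalFunction hy).deriv
  rw [heq.deriv_eq, heq.eq_of_nhds, (hasDerivAt_integralFromZero
    differentiable_exp_cube_sub_one_div.differentiableOn hz).cexp.deriv]
  rcases eq_or_ne z 0 with rfl | hz0
  · simp
  · have := Complex.exp_ne_zero (integralFromZero (fun t => (Complex.exp (t ^ 3) - 1) / t) z)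
    field_simp
    ring

theorem extremalFunction_mem_convexClassExp : extremalFunction ∈ convexClassExp := by
  refine ⟨isNormalizedAnalytic_extremalFunction, fun z hz => deriv_extremalFunction_ne_zero hz,
    ?_, Complex.differentiable_exp.differentiableOn, fun z => z ^ 3,
    ⟨by fun_prop, by simp, fun z hz => ?_⟩,
    fun z hz => one_add_mul_deriv_deriv_extremalFunction hz⟩
  · have : Differentiable ℂ fun z : ℂ => Complex.exp (z ^ 3) := by fun_prop
    exact this.differentiableOn.congr fun z hz => one_add_mul_deriv_deriv_extremalFunction hz
  · rw [norm_pow]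
    exact pow_le_of_le_one (norm_nonneg z) (mem_ball_zero_iff.mp hz).le (by norm_num)

theorem hankelDet_extremalFunction : hankelDet 3 1 extremalFunction = -1 / 144 := by
  have h := hankelDet_eq_of_exp_comp isNormalizedAnalytic_extremalFunction
    (fun z hz => deriv_extremalFunction_ne_zero hz) (w := fun z => z ^ 3) (by fun_prop) (by simp)
    (fun z hz => one_add_mul_deriv_deriv_extremalFunction hz)
  simp only [taylorCoeff_pow] at h
  norm_num at h
  linear_combination h / 144

theorem theorem5 :
    (∀ f ∈ convexClassExp, ‖hankelDet 3 1 f‖ ≤ 1 / 144) ∧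
      extremalFunction ∈ convexClassExp ∧
      ‖hankelDet 3 1 extremalFunction‖ = 1 / 144 := by
  refine ⟨fun f hf => norm_hankelDet_le hf, extremalFunction_mem_convexClassExp, ?_⟩
  rw [hankelDet_extremalFunction]
  norm_num
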